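/- Let $d\ge 2$. For a state (density matrix) $\varrho$ on $\mathbb C^d\otimes\mathbb C^d$ put $$B_2(\varrho,\sigma)=2\log_2 d+S(\varrho|\sigma)+\log_2\|\sigma^{\Gamma}\|_{op},\qquad B_2(\varrho)=\min_{\sigma}B_2(\varrho,\sigma),$$ where $\sigma$ ranges over all states on $\mathbb C^d\otimes\mathbb C^d$, $\Gamma=I\otimes T$ is the partial transpose, $\|\cdot\|_{op}$ is the operator norm, and $S(\varrho|\sigma)=\mathrm{tr}\,\varrho\log_2\varrho-\mathrm{tr}\,\varrho\log_2\sigma$ is the relative entropy, equal to $+\infty$ if the support of $\varrho$ is not contained in that of $\sigma$. Let $S(\varrho)=-\mathrm{tr}\,\varrho\log_2\varrho$, with $0\log_2 0=0$. For $-\frac1{d^2-1}\le\lambda\le1$ let $$\varrho_{iso}=\lambda P_++\frac{1-\lambda}{d^2}I$$ be the isotropic state with parameter $\lambda$, where $P_+$ is the projector onto $\frac1{\sqrt d}\sum_i|i\rangle\otimes|i\rangle$. (1) For every state $\sigma$ the twirled operator $\bar\sigma=\int (U\otimes U^*)\,\sigma\,(U\otimes U^*)^\dagger\,dU$ (Haar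 probability measure on the unitary group $U(d)$, $U^*$ the complex conjugate of $U$) is an isotropic state, and $B_2(\varrho_{iso},\bar\sigma)\le B_2(\varrho_{iso},\sigma)$. The minimum defining $B_2(\varrho_{iso})$ exists and is attained at an isotropic state. (2) The entropy is $$S(\varrho_{iso})=-\frac{1+\lambda(d^2-1)}{d^2}\log_2\frac{1+\lambda(d^2-1)}{d^2}-\frac{(1-\lambda)(d^2-1)}{d^2}\log_2\frac{1-\lambda}{d^2}.$$ (3) If $-\frac1{d^2-1}\le\lambda\le\frac1{d+1}$, then $B_2(\varrho_{iso})=2\log_2d-S(\varrho_{iso})$. (4) If $\frac1{d+1}\le\lambda<1$, then, with $p=\dfrac{(d+1)\lambda-1}{(1-d^2)(\lambda-1)+d}$, $$B_2(\varrho_{iso})=2\log_2d-S(\varrho_{iso})+\log_2\frac{1+p(d-1)}{1-p}+\frac{1+\lambda(d^2-1)}{d^2}\log_2\frac{1-p}{1+p(d^2-1)},$$ and for $\lambda=1$, where $p=1$ and the right-hand side is read as its limit, $B_2(\varrho_{iso})=\log_2 d$. -/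

import Mathlib

open scoped Kronecker ComplexOrder

noncomputable section

namespace QInfo

/-- Operators on `ℂᵈ ⊗ ℂᵈ`, written as matrices in the product basis `|i⟩ ⊗ |j⟩`. -/
abbrev Op (d : ℕ) : Type := Matrix (Fin d × Fin d) (Fin d × Fin d) ℂ

/-- Density matrices: positive semidefinite of trace one. -/
def IsState {d : ℕ} (ρ : Op d) : Prop := ρ.PosSemidef ∧ ρ.trace = 1

/-- The partial transpose `Γ = I ⊗ T` (transposition of the second factor). -/
def partialTranspose {d : ℕ} (A : Op d) : Op d :=
  Matrix.of fun a b => A (a.1, b.2) (b.1, a.2)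

/-- The operator norm on the Hilbert space `ℂᵈ ⊗ ℂᵈ`. -/
def opNorm {d : ℕ} (A : Op d) : ℝ :=
  ‖Matrix.toEuclideanCLM (n := Fin d × Fin d) (𝕜 := ℂ) A‖

/-- The logarithm to base two of a Hermitian matrix, by functional calculus. It vanishes on the
kernel, because `Real.logb 2 0 = 0`. -/
def matLog {d : ℕ} (A : Op d) : Op d := cfc (Real.logb 2) A

/-- Von Neumann entropy `S(ρ) = - tr ρ log₂ ρ`, with `0 log₂ 0 = 0`. -/
def entropy {d : ℕ} (ρ : Op d) : ℝ := -((ρ * matLog ρ).trace).re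

open Classical in
/-- Relative entropy `S(ρ|σ) = tr ρ log₂ ρ - tr ρ log₂ σ` if the support of `ρ` lies in the support
of `σ` (that is, `ker σ ⊆ ker ρ`), and `+∞` otherwise. -/
def relEntropy {d : ℕ} (ρ σ : Op d) : EReal :=
  if ∀ v : Fin d × Fin d → ℂ, σ.mulVec v = 0 → ρ.mulVec v = 0 then
    ((((ρ * matLog ρ).trace).re - ((ρ * matLog σ).trace).re : ℝ) : EReal)
  else ⊤

/-- `B₂(ρ,σ) = 2 log₂ d + S(ρ|σ) + log₂ ‖σ^Γ‖_op`. -/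
def B2pair {d : ℕ} (ρ σ : Op d) : EReal :=
  ((2 * Real.logb 2 (d : ℝ) : ℝ) : EReal) + relEntropy ρ σ
    + ((Real.logb 2 (opNorm (partialTranspose σ)) : ℝ) : EReal)

/-- `B₂(ρ)`: the infimum of `B₂(ρ,σ)` over all states `σ`. -/
def B2 {d : ℕ} (ρ : Op d) : EReal := ⨅ σ : {σ : Op d // IsState σ}, B2pair ρ σ.1

/-- `σ` is optimal for `ρ`: it is a state at which the minimum `B₂(ρ)` is attained. -/
def IsOptimal {d : ℕ} (ρ σ : Op d) : Prop := IsState σ ∧ B2pair ρ σ = B2 ρ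

/-- The projector `P₊` onto the maximally entangled vector `d^{-1/2} ∑ᵢ |i⟩ ⊗ |i⟩`. -/
def maxEnt (d : ℕ) : Op d :=
  Matrix.of fun a b => if a.1 = a.2 ∧ b.1 = b.2 then ((d : ℂ))⁻¹ else 0

/-- `λ P₊ + (1-λ)/d² I`. -/
def iso (d : ℕ) (lam : ℝ) : Op d :=
  (lam : ℂ) • maxEnt d + (((1 - lam) / (d : ℝ) ^ 2 : ℝ) : ℂ) • (1 : Op d)

/-- The range of the parameter in which `iso d lam` is a state. -/
def isoRange (d : ℕ) : Set ℝ := Set.Icc (-1 / ((d : ℝ) ^ 2 - 1)) 1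

/-! The unitary group as a compact group, with its normalized Haar measure. -/

instance instCompactUnitary (d : ℕ) : CompactSpace (Matrix.unitaryGroup (Fin d) ℂ) := by
  suffices h : IsCompact (Matrix.unitaryGroup (Fin d) ℂ : Set (Matrix (Fin d) (Fin d) ℂ)) from
    isCompact_iff_compactSpace.mp h
  have hK : IsCompact (Set.univ.pi fun _ : Fin d => Set.univ.pi fun _ : Fin d =>
      Metric.closedBall (0 : ℂ) 1) :=
    isCompact_univ_pi fun _ => isCompact_univ_pi fun _ => isCompact_closedBall _ _
  refine hK.of_isClosed_subset (isClosed_unitary (R := Matrix (Fin d) (Fin d) ℂ)) ?_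
  intro U hU i _ j _
  rw [mem_closedBall_zero_iff]
  exact entry_norm_bound_of_unitary hU i j

instance instMeasurableUnitary (d : ℕ) : MeasurableSpace (Matrix.unitaryGroup (Fin d) ℂ) :=
  borel _

instance instBorelUnitary (d : ℕ) : BorelSpace (Matrix.unitaryGroup (Fin d) ℂ) := ⟨rfl⟩

/-- The Haar probability measure on the unitary group. -/
def haarU (d : ℕ) : MeasureTheory.Measure (Matrix.unitaryGroup (Fin d) ℂ) :=
  MeasureTheory.Measure.haarMeasure ⊤

/-- `U ⊗ U*`, where `U*` is the entrywise complex conjugate of `U`. -/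
def conjPair {d : ℕ} (U : Matrix.unitaryGroup (Fin d) ℂ) : Op d :=
  (U : Matrix (Fin d) (Fin d) ℂ) ⊗ₖ ((U : Matrix (Fin d) (Fin d) ℂ).map star)

/-- The `U ⊗ U*` twirl `∫ (U ⊗ U*) σ (U ⊗ U*)† dU`, integrated entry by entry. -/
def twirl {d : ℕ} (σ : Op d) : Op d :=
  Matrix.of fun a b =>
    ∫ U : Matrix.unitaryGroup (Fin d) ℂ,
      (conjPair U * σ * (conjPair U).conjTranspose) a b ∂(haarU d)

/-- The parameter `p = ((d+1)λ - 1) / ((1-d²)(λ-1) + d)`. -/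
def pParam (d : ℕ) (lam : ℝ) : ℝ :=
  (((d : ℝ) + 1) * lam - 1) / ((1 - (d : ℝ) ^ 2) * (lam - 1) + d)

end QInfo

end

/-! The proof turns on the overlap `F = tr(P₊ σ)`. The twirl keeps the trace and `F`, and an
operator invariant under all `U ⊗ U*` is a combination of `P₊` and `I`; so the twirl of `σ` is the
isotropic state `iso d q` with top eigenvalue `isoTop d q = F`. For a fixed `F` this state is the
best choice in both terms of `B₂`.

Entropy term (`iso_trace_matLog_le`): in an eigenbasis of `σ` with eigenvalues `s i`, the weights `w
i` of `P₊` sum to 1 and average `s` to `F`; the weights `1 - w i` of the complement sum to `d² - 1`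
and average `s` to the other eigenvalue of `iso d q`. Jensen's inequality for each family bounds `tr
ρ log σ`.

Norm term (`isoNorm_le_opNorm`): `Γ` turns `P₊` into the swap divided by `d`. Testing `σ^Γ` against
`1 ± swap`, twice a projection, bounds `‖σ^Γ‖` below by a function of `F` which equals the norm for
`iso d q` when the sign is that of `q`.

There remains one real variable `q`. With `A`, `f`, `g`, `N` standing for `isoTop d lam`, `isoTop d
q`, `isoBot d q`, `isoNorm d q`, minimize `-(A log f + (1 - A) log g) + log N`. Jensen settles it
again: applied to `f`, `g` when `A ≤ 1/d`, with minimizer `q = 0`, and to the ratios of `f`, `g` to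
their values at `p` when `A ≥ 1/d`. The condition `A = 1/d` is `lam = 1/(d+1)`. -/

namespace QInfo

/-! ### Eigenvalues of isotropic states -/

/-- The eigenvalue of `iso d q` on the maximally entangled vector. -/
noncomputable def isoTop (d : ℕ) (q : ℝ) : ℝ := (1 + q * ((d : ℝ) ^ 2 - 1)) / (d : ℝ) ^ 2

/-- The eigenvalue of `iso d q` on the orthogonal complement of the maximally entangled vector. -/
noncomputable def isoBot (d : ℕ) (q : ℝ) : ℝ := (1 - q) / (d : ℝ) ^ 2

/-- The operator norm of the partial transpose of `iso d q`. -/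
noncomputable def isoNorm (d : ℕ) (q : ℝ) : ℝ := isoBot d q + |q| / d

theorem two_le_cast {d : ℕ} (hd : 2 ≤ d) : (2 : ℝ) ≤ d := by exact_mod_cast hd

theorem isoTop_sub_isoBot {d : ℕ} (hd : 2 ≤ d) (q : ℝ) : isoTop d q - isoBot d q = q := by
  have := two_le_cast hd
  unfold isoTop isoBot
  field_simp
  ring

theorem isoTop_add {d : ℕ} (hd : 2 ≤ d) (q : ℝ) :
    isoTop d q + ((d : ℝ) ^ 2 - 1) * isoBot d q = 1 := by
  have := two_le_cast hd
  unfold isoTop isoBot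
  field_simp
  ring

theorem isoBot_eq {d : ℕ} (hd : 2 ≤ d) (q : ℝ) :
    isoBot d q = (1 - isoTop d q) / ((d : ℝ) ^ 2 - 1) := by
  have h2 := two_le_cast hd
  rw [eq_div_iff (by nlinarith)]
  linarith [isoTop_add hd q]

theorem isoTop_nonneg {d : ℕ} (hd : 2 ≤ d) {q : ℝ} (hq : q ∈ isoRange d) : 0 ≤ isoTop d q := by
  have h2 := two_le_cast hd
  have h3 : (0 : ℝ) < (d : ℝ) ^ 2 - 1 := by nlinarith
  have := hq.1
  rw [div_le_iff₀ h3] at this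
  exact div_nonneg (by linarith) (by positivity)

theorem isoBot_nonneg {d : ℕ} {q : ℝ} (hq : q ∈ isoRange d) : 0 ≤ isoBot d q :=
  div_nonneg (by linarith [hq.2]) (by positivity)

theorem isoTop_le_one {d : ℕ} (hd : 2 ≤ d) {q : ℝ} (hq : q ∈ isoRange d) : isoTop d q ≤ 1 := by
  have h2 := two_le_cast hd
  have := isoTop_add hd q
  have := mul_nonneg (show (0 : ℝ) ≤ (d : ℝ) ^ 2 - 1 by nlinarith) (isoBot_nonneg hq)
  linarith

/-! ### Jensen's inequality for the logarithm -/

/-- Jensen's inequality for the logarithm, where a vanishing argument needs a vanishing weight. -/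
theorem sum_mul_logb_le {ι : Type*} [Fintype ι] (w s : ι → ℝ) (hw : ∀ i, 0 ≤ w i)
    (hs : ∀ i, 0 ≤ s i) (h0 : ∀ i, s i = 0 → w i = 0) {W c : ℝ} (hW : ∑ i, w i = W)
    (hc : ∑ i, w i * s i = W * c) :
    ∑ i, w i * Real.logb 2 (s i) ≤ W * Real.logb 2 c := by
  have hl : 0 < Real.log 2 := Real.log_pos (by norm_num)
  have hWn : 0 ≤ W := hW ▸ Finset.sum_nonneg fun i _ => hw i
  have hpos : ∀ i, w i ≠ 0 → 0 < s i := fun i hi =>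
    lt_of_le_of_ne (hs i) fun h => hi (h0 i h.symm)
  rcases hWn.eq_or_lt with h | hWpos
  · have hz : ∀ i, w i = 0 := fun i =>
      (Finset.sum_eq_zero_iff_of_nonneg fun i _ => hw i).1 (hW.trans h.symm) i (Finset.mem_univ i)
    simp [hz, ← h]
  have hcpos : 0 < c := by
    refine pos_of_mul_pos_right (a := W) ?_ hWn
    rw [← hc]
    refine lt_of_le_of_ne (Finset.sum_nonneg fun i _ => mul_nonneg (hw i) (hs i)) fun h => ?_
    have hz : ∀ i, w i * s i = 0 := fun i =>
      (Finset.sum_eq_zero_iff_of_nonneg fun i _ => mul_nonneg (hw i) (hs i)).1 h.symm i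
        (Finset.mem_univ i)
    have hz' : ∀ i, w i = 0 := fun i => by
      by_contra hi
      exact (mul_pos (lt_of_le_of_ne (hw i) (Ne.symm hi)) (hpos i hi)).ne' (hz i)
    simp [hz'] at hW
    exact hWpos.ne hW
  -- The tangent line of `log` at `c`, weighted by `w i`; summing makes the linear part cancel,
  -- since `c` is the weighted mean.
  have key : ∀ i, w i * Real.log (s i) ≤ w i * (Real.log c - 1) + w i * s i / c := fun i => by
    by_cases hi : w i = 0
    · simp [hi]
    have hsi := hpos i hi
    have h1 := Real.log_le_sub_one_of_pos (div_pos hsi hcpos)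
    rw [Real.log_div hsi.ne' hcpos.ne'] at h1
    have h2 := mul_le_mul_of_nonneg_left h1 (hw i)
    have h3 : w i * s i / c = w i * (s i / c) := by ring
    rw [h3]
    linarith
  have hsum : ∑ i, w i * Real.log (s i) ≤ W * Real.log c := by
    refine (Finset.sum_le_sum fun i _ => key i).trans_eq ?_
    rw [Finset.sum_add_distrib, ← Finset.sum_mul, ← Finset.sum_div, hW, hc]
    field_simp
    ring
  have hdiv := div_le_div_of_nonneg_right hsum hl.le
  simpa [Real.logb, Finset.sum_div, mul_div_assoc] using hdiv

theorem two_point_logb_le {A x y : ℝ} (hA : 0 ≤ A) (hA1 : A ≤ 1) (hx : 0 ≤ x) (hy : 0 ≤ y)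
    (hx0 : x = 0 → A = 0) (hy0 : y = 0 → 1 - A = 0) :
    A * Real.logb 2 x + (1 - A) * Real.logb 2 y ≤ Real.logb 2 (A * x + (1 - A) * y) := by
  have := sum_mul_logb_le ![A, 1 - A] ![x, y]
    (by intro i; fin_cases i <;> simp [hA, hA1]) (by intro i; fin_cases i <;> simp [hx, hy])
    (by intro i; fin_cases i <;> simpa) (W := 1) (c := A * x + (1 - A) * y) (by simp) (by simp)
  simpa using this

theorem two_point_pos {A x y : ℝ} (hA : 0 ≤ A) (hA1 : A ≤ 1) (hx : 0 ≤ x) (hy : 0 ≤ y)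
    (hx0 : x = 0 → A = 0) (hy0 : y = 0 → 1 - A = 0) : 0 < A * x + (1 - A) * y := by
  rcases hA.eq_or_lt with h | h
  · have : y ≠ 0 := fun hh => by have := hy0 hh; linarith
    have := lt_of_le_of_ne hy this.symm
    rw [← h]; linarith
  · have : x ≠ 0 := fun hh => by have := hx0 hh; linarith
    have := mul_pos h (lt_of_le_of_ne hx this.symm)
    have := mul_nonneg (sub_nonneg.2 hA1) hy
    linarith

/-! ### Minimization over the isotropic parameter -/

/-- The part of `B₂(iso d lam, iso d q)` that depends on `q`. -/
noncomputable def isoObjective (d : ℕ) (lam q : ℝ) : ℝ :=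
  -(isoTop d lam * Real.logb 2 (isoTop d q) + (1 - isoTop d lam) * Real.logb 2 (isoBot d q))
    + Real.logb 2 (isoNorm d q)

/-- The support of `iso d lam` is contained in that of `iso d q`. -/
def IsoSupp (d : ℕ) (lam q : ℝ) : Prop :=
  (isoTop d q = 0 → isoTop d lam = 0) ∧ (isoBot d q = 0 → 1 - isoTop d lam = 0)

theorem isoNorm_pos {d : ℕ} (hd : 2 ≤ d) {q : ℝ} (hq : q ∈ isoRange d) : 0 < isoNorm d q := by
  have h2 := two_le_cast hd
  by_cases h : q = 0
  · have h0 : isoNorm d 0 = 1 / (d : ℝ) ^ 2 := by simp [isoNorm, isoBot]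
    rw [h, h0]
    positivity
  · have := isoBot_nonneg hq
    have : 0 < |q| / d := div_pos (abs_pos.2 h) (by linarith)
    unfold isoNorm; linarith

/-- The source of the threshold `1/(d+1)`: the two cases differ in whether `A * q ≤ |q| / d` holds
for all `q`, that is, in whether `A ≤ 1/d`. -/
theorem isoTop_le_inv_iff {d : ℕ} (hd : 2 ≤ d) (lam : ℝ) :
    isoTop d lam ≤ 1 / d ↔ lam ≤ 1 / ((d : ℝ) + 1) := by
  have h2 := two_le_cast hd
  have h1 : (0 : ℝ) < d - 1 := by linarith
  unfold isoTop
  rw [div_le_div_iff₀ (by positivity) (by positivity), le_div_iff₀ (by positivity)]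
  constructor
  · intro h
    have : (d * (d - 1) : ℝ) * (lam * (d + 1)) ≤ d * (d - 1) * 1 := by nlinarith
    exact le_of_mul_le_mul_left this (by positivity)
  · intro h
    have := mul_le_mul_of_nonneg_left h (show (0 : ℝ) ≤ d * (d - 1) by positivity)
    nlinarith

theorem isoObjective_zero {d : ℕ} (lam : ℝ) : isoObjective d lam 0 = 0 := by
  simp [isoObjective, isoTop, isoBot, isoNorm]
  ring

theorem isoObjective_nonneg {d : ℕ} (hd : 2 ≤ d) {lam q : ℝ} (hlam : lam ∈ isoRange d)
    (h : lam ≤ 1 / ((d : ℝ) + 1)) (hq : q ∈ isoRange d) (hs : IsoSupp d lam q) :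
    0 ≤ isoObjective d lam q := by
  have h2 := two_le_cast hd
  have hA := isoTop_nonneg hd hlam
  have hA1 := isoTop_le_one hd hlam
  have hf := isoTop_nonneg hd hq
  have hg := isoBot_nonneg hq
  have hj := two_point_logb_le hA hA1 hf hg hs.1 hs.2
  have hp := two_point_pos hA hA1 hf hg hs.1 hs.2
  -- Since `f = g + q`, the mean `A f + (1 - A) g` is `g + A q`, to be compared with `N = g + |q| /
  -- d`.
  have hle : isoTop d lam * isoTop d q + (1 - isoTop d lam) * isoBot d q ≤ isoNorm d q := by
    have e := isoTop_sub_isoBot hd q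
    have e' : isoTop d q = q + isoBot d q := by linarith
    have hAd := (isoTop_le_inv_iff hd lam).2 h
    have h3 : isoTop d lam * q ≤ |q| / d := calc
      isoTop d lam * q ≤ isoTop d lam * |q| := mul_le_mul_of_nonneg_left (le_abs_self q) hA
      _ ≤ 1 / d * |q| := mul_le_mul_of_nonneg_right hAd (abs_nonneg q)
      _ = |q| / d := by ring
    unfold isoNorm
    rw [e']
    linarith
  have := Real.logb_le_logb_of_le (b := 2) (by norm_num) hp hle
  unfold isoObjective
  linarith

theorem pParam_denom_pos {d : ℕ} (hd : 2 ≤ d) {lam : ℝ} (h1 : lam ≤ 1) :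
    0 < (1 - (d : ℝ) ^ 2) * (lam - 1) + d := by
  have h2 := two_le_cast hd
  nlinarith [mul_nonneg (show (0 : ℝ) ≤ (d : ℝ) ^ 2 - 1 by nlinarith) (sub_nonneg.2 h1)]

theorem pParam_nonneg {d : ℕ} (hd : 2 ≤ d) {lam : ℝ} (h : 1 / ((d : ℝ) + 1) ≤ lam)
    (h1 : lam ≤ 1) : 0 ≤ pParam d lam := by
  have h2 := two_le_cast hd
  rw [div_le_iff₀ (by positivity)] at h
  exact div_nonneg (by linarith) (pParam_denom_pos hd h1).le

theorem one_sub_pParam {d : ℕ} (hd : 2 ≤ d) {lam : ℝ} (h1 : lam ≤ 1) :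
    1 - pParam d lam = (d * (d + 1)) * (1 - lam) / ((1 - (d : ℝ) ^ 2) * (lam - 1) + d) := by
  have := (pParam_denom_pos hd h1).ne'
  unfold pParam
  field_simp
  ring

theorem pParam_mem {d : ℕ} (hd : 2 ≤ d) {lam : ℝ} (h : 1 / ((d : ℝ) + 1) ≤ lam)
    (h1 : lam ≤ 1) : pParam d lam ∈ isoRange d := by
  have h2 := two_le_cast hd
  have hn := pParam_nonneg hd h h1
  refine ⟨(div_nonpos_of_nonpos_of_nonneg (by norm_num) (by nlinarith)).trans hn, ?_⟩
  have := one_sub_pParam hd h1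
  have h3 : 0 ≤ (d * (d + 1)) * (1 - lam) / ((1 - (d : ℝ) ^ 2) * (lam - 1) + d) :=
    div_nonneg (mul_nonneg (by positivity) (by linarith)) (pParam_denom_pos hd h1).le
  linarith

theorem isoNorm_of_nonneg {d : ℕ} (hd : 2 ≤ d) {q : ℝ} (hq : 0 ≤ q) :
    isoNorm d q = (1 + q * (d - 1)) / (d : ℝ) ^ 2 := by
  have h2 := two_le_cast hd
  rw [isoNorm, abs_of_nonneg hq, isoBot]
  field_simp
  ring

/-- With `isoBot_pParam`, this is the stationarity condition that determines `p`: for `q ≥ 0` one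
has `d N = f + (d - 1) g`, and at the optimum the two summands stand in the ratio `A : (1 - A)`. -/
theorem isoTop_pParam {d : ℕ} (hd : 2 ≤ d) {lam : ℝ} (h : 1 / ((d : ℝ) + 1) ≤ lam)
    (h1 : lam ≤ 1) :
    isoTop d (pParam d lam) = isoTop d lam * (d * isoNorm d (pParam d lam)) := by
  have h2 := two_le_cast hd
  rw [isoNorm_of_nonneg hd (pParam_nonneg hd h h1)]
  have := (pParam_denom_pos hd h1).ne'
  unfold isoTop pParam
  field_simp
  ring

theorem isoBot_pParam {d : ℕ} (hd : 2 ≤ d) {lam : ℝ} (h : 1 / ((d : ℝ) + 1) ≤ lam)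
    (h1 : lam ≤ 1) :
    (d - 1) * isoBot d (pParam d lam) =
      (1 - isoTop d lam) * (d * isoNorm d (pParam d lam)) := by
  have h2 := two_le_cast hd
  rw [isoNorm_of_nonneg hd (pParam_nonneg hd h h1)]
  have := (pParam_denom_pos hd h1).ne'
  unfold isoTop isoBot pParam
  field_simp
  ring

theorem isoSupp_pParam {d : ℕ} (hd : 2 ≤ d) {lam : ℝ} (h : 1 / ((d : ℝ) + 1) ≤ lam)
    (h1 : lam ≤ 1) : IsoSupp d lam (pParam d lam) := by
  have h2 := two_le_cast hd
  have hN := isoNorm_pos hd (pParam_mem hd h h1)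
  have hdN : (d : ℝ) * isoNorm d (pParam d lam) ≠ 0 := by positivity
  constructor <;> intro h0
  · have := isoTop_pParam hd h h1
    rw [h0] at this
    exact (mul_eq_zero.1 this.symm).resolve_right hdN
  · have := isoBot_pParam hd h h1
    rw [h0, mul_zero] at this
    exact (mul_eq_zero.1 this.symm).resolve_right hdN

/-- Primes denote values at `p`. Jensen for `f / f'` and `g / g'` with weights `A` and `1 - A`
bounds the difference of the logarithmic terms by the logarithm of the mean. By stationarity of `p`
that mean is at most `(f + (d - 1) g) / (d N')`, hence at most `N / N'`. -/
theorem isoObjective_pParam_le {d : ℕ} (hd : 2 ≤ d) {lam q : ℝ} (hlam : lam ∈ isoRange d)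
    (h : 1 / ((d : ℝ) + 1) ≤ lam) (hq : q ∈ isoRange d) (hs : IsoSupp d lam q) :
    isoObjective d lam (pParam d lam) ≤ isoObjective d lam q := by
  have h2 := two_le_cast hd
  have hA := isoTop_nonneg hd hlam
  have hA1 := isoTop_le_one hd hlam
  have hf := isoTop_nonneg hd hq
  have hg := isoBot_nonneg hq
  have hf' := isoTop_nonneg hd (pParam_mem hd h hlam.2)
  have hg' := isoBot_nonneg (pParam_mem hd h hlam.2)
  have hN := isoNorm_pos hd hq
  have hN' := isoNorm_pos hd (pParam_mem hd h hlam.2)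
  have ht := isoTop_pParam hd h hlam.2
  have hb := isoBot_pParam hd h hlam.2
  have hs' := isoSupp_pParam hd h hlam.2
  unfold isoObjective
  have e := isoTop_sub_isoBot hd q
  set A := isoTop d lam
  set f := isoTop d q
  set g := isoBot d q
  set f' := isoTop d (pParam d lam)
  set g' := isoBot d (pParam d lam)
  set N := isoNorm d q with hNdef
  set N' := isoNorm d (pParam d lam)
  have hNle : (f + (d - 1) * g) / d ≤ N := by
    rw [hNdef, isoNorm, show f = q + g by linarith]
    change _ ≤ g + _
    have := div_le_div_of_nonneg_right (le_abs_self q) (show (0 : ℝ) ≤ d by linarith)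
    have e2 : (q + g + (d - 1) * g) / d = g + q / d := by field_simp; ring
    linarith
  have hj := two_point_logb_le hA hA1 (div_nonneg hf hf') (div_nonneg hg hg')
    (fun h0 => (div_eq_zero_iff.1 h0).elim hs.1 hs'.1)
    (fun h0 => (div_eq_zero_iff.1 h0).elim hs.2 hs'.2)
  have hp := two_point_pos hA hA1 (div_nonneg hf hf') (div_nonneg hg hg')
    (fun h0 => (div_eq_zero_iff.1 h0).elim hs.1 hs'.1)
    (fun h0 => (div_eq_zero_iff.1 h0).elim hs.2 hs'.2)
  have h1 : A * Real.logb 2 (f / f') = A * Real.logb 2 f - A * Real.logb 2 f' := by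
    by_cases h0 : A = 0
    · simp [h0]
    rw [Real.logb_div (fun hh => h0 (hs.1 hh)) (fun hh => h0 (hs'.1 hh))]
    ring
  have h1' : (1 - A) * Real.logb 2 (g / g') =
      (1 - A) * Real.logb 2 g - (1 - A) * Real.logb 2 g' := by
    by_cases h0 : 1 - A = 0
    · simp [h0]
    rw [Real.logb_div (fun hh => h0 (hs.2 hh)) (fun hh => h0 (hs'.2 hh))]
    ring
  -- A vanishing denominator occurs only with weight zero (as `g' = 0` at `lam = 1`); the term is
  -- then 0, so inequalities rather than equalities are shown for the two summands.
  have hle : A * (f / f') + (1 - A) * (g / g') ≤ N / N' := by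
    have ha : A * (f / f') ≤ f / (d * N') := by
      by_cases h0 : A = 0
      · rw [h0, zero_mul]; positivity
      · rw [ht]; apply le_of_eq; field_simp
    have hb' : (1 - A) * (g / g') ≤ (d - 1) * g / (d * N') := by
      by_cases h0 : 1 - A = 0
      · rw [h0, zero_mul]
        exact div_nonneg (mul_nonneg (by linarith) hg) (by positivity)
      · have : g' ≠ 0 := fun hh => h0 (hs'.2 hh)
        apply le_of_eq
        rw [← mul_div_assoc, div_eq_div_iff this (by positivity)]
        linear_combination (-g) * hb
    calc _ ≤ f / (d * N') + (d - 1) * g / (d * N') := add_le_add ha hb'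
      _ = (f + (d - 1) * g) / d / N' := by field_simp
      _ ≤ N / N' := by gcongr
  have := Real.logb_le_logb_of_le (b := 2) (by norm_num) hp hle
  rw [Real.logb_div hN.ne' hN'.ne'] at this
  linarith

/-- Here `p = 1` and `isoBot d 1 = 0`, but its logarithm has weight `1 - A = 0`; only `log N = log
(1/d)` is left. -/
theorem isoObjective_pParam_one {d : ℕ} (hd : 2 ≤ d) :
    isoObjective d 1 (pParam d 1) = -Real.logb 2 d := by
  have h2 := two_le_cast hd
  have h0 : (d : ℝ) ≠ 0 := by positivity
  have hp : pParam d 1 = 1 := by simp [pParam, h0]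
  have ht : isoTop d 1 = 1 := by simp [isoTop, h0]
  simp [isoObjective, hp, ht, isoNorm, isoBot, Real.logb_inv]

theorem isoObjective_pParam_of_lt_one {d : ℕ} (hd : 2 ≤ d) {lam : ℝ}
    (h : 1 / ((d : ℝ) + 1) ≤ lam) (h1 : lam < 1) :
    isoObjective d lam (pParam d lam) =
      Real.logb 2 ((1 + pParam d lam * ((d : ℝ) - 1)) / (1 - pParam d lam))
        + (1 + lam * ((d : ℝ) ^ 2 - 1)) / (d : ℝ) ^ 2
          * Real.logb 2 ((1 - pParam d lam) / (1 + pParam d lam * ((d : ℝ) ^ 2 - 1))) := by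
  have h2 := two_le_cast hd
  have hn := pParam_nonneg hd h h1.le
  have hg : 0 < 1 - pParam d lam := by
    rw [one_sub_pParam hd h1.le]
    exact div_pos (mul_pos (by positivity) (by linarith)) (pParam_denom_pos hd h1.le)
  have hm := isoNorm_of_nonneg hd hn
  unfold isoObjective
  rw [hm]
  change -(_ * Real.logb 2 (_ / _) + _ * Real.logb 2 (_ / _)) + Real.logb 2 (_ / _) = _
  have hx : 0 < 1 + pParam d lam * ((d : ℝ) - 1) := by
    have := mul_nonneg hn (show (0 : ℝ) ≤ d - 1 by linarith)
    linarith
  have hy : 0 < 1 + pParam d lam * ((d : ℝ) ^ 2 - 1) := by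
    have := mul_nonneg hn (show (0 : ℝ) ≤ (d : ℝ) ^ 2 - 1 by nlinarith)
    linarith
  have hD : (d : ℝ) ^ 2 ≠ 0 := by positivity
  rw [Real.logb_div hy.ne' hD, Real.logb_div hg.ne' hD, Real.logb_div hx.ne' hD,
    Real.logb_div hx.ne' hg.ne', Real.logb_div hg.ne' hy.ne']
  unfold isoTop
  ring

/-! ### Spectral calculus, entropy and support of isotropic states -/

theorem maxEnt_isHermitian (d : ℕ) : (maxEnt d).IsHermitian := by
  ext a b
  simp [maxEnt, Matrix.conjTranspose_apply, and_comm, apply_ite (starRingEnd ℂ)]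

theorem maxEnt_mul_self {d : ℕ} (hd : 2 ≤ d) : maxEnt d * maxEnt d = maxEnt d := by
  have h0 : (d : ℂ) ≠ 0 := by exact_mod_cast (by omega : d ≠ 0)
  ext a b
  by_cases ha : a.1 = a.2 <;> by_cases hb : b.1 = b.2 <;>
    simp [maxEnt, Matrix.mul_apply, Fintype.sum_prod_type, ha, hb, Finset.sum_ite_eq, h0]

theorem trace_maxEnt {d : ℕ} (hd : 2 ≤ d) : (maxEnt d).trace = 1 := by
  have h0 : (d : ℂ) ≠ 0 := by exact_mod_cast (by omega : d ≠ 0)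
  simp [maxEnt, Matrix.trace, Fintype.sum_prod_type, h0]

theorem iso_eq {d : ℕ} (hd : 2 ≤ d) (q : ℝ) :
    iso d q = (isoTop d q : ℂ) • maxEnt d + (isoBot d q : ℂ) • (1 - maxEnt d) := by
  have h := isoTop_sub_isoBot hd q
  have h' : (q : ℂ) = isoTop d q - isoBot d q := by exact_mod_cast h.symm
  unfold iso
  rw [h', smul_sub, sub_smul]
  change _ + (isoBot d q : ℂ) • _ = _
  abel

theorem posSemidef_of_projection {n : Type*} [Fintype n] {P : Matrix n n ℂ}
    (h : P.IsHermitian) (h2 : P * P = P) : P.PosSemidef := by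
  have := Matrix.posSemidef_conjTranspose_mul_self P
  rwa [h.eq, h2] at this

theorem maxEnt_posSemidef {d : ℕ} (hd : 2 ≤ d) : (maxEnt d).PosSemidef :=
  posSemidef_of_projection (maxEnt_isHermitian d) (maxEnt_mul_self hd)

theorem one_sub_maxEnt_posSemidef {d : ℕ} (hd : 2 ≤ d) : (1 - maxEnt d).PosSemidef := by
  refine posSemidef_of_projection (Matrix.isHermitian_one.sub (maxEnt_isHermitian d)) ?_
  simp [mul_sub, sub_mul, maxEnt_mul_self hd]

theorem iso_posSemidef {d : ℕ} (hd : 2 ≤ d) {q : ℝ} (hq : q ∈ isoRange d) :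
    (iso d q).PosSemidef := by
  rw [iso_eq hd]
  exact ((maxEnt_posSemidef hd).smul (by exact_mod_cast isoTop_nonneg hd hq)).add
    ((one_sub_maxEnt_posSemidef hd).smul (by exact_mod_cast isoBot_nonneg hq))

theorem trace_one_sub_maxEnt {d : ℕ} (hd : 2 ≤ d) :
    (1 - maxEnt d).trace = ((d : ℂ) ^ 2 - 1) := by
  rw [Matrix.trace_sub, trace_maxEnt hd, Matrix.trace_one]
  simp [sq]

theorem isState_iso {d : ℕ} (hd : 2 ≤ d) {q : ℝ} (hq : q ∈ isoRange d) : IsState (iso d q) := by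
  refine ⟨iso_posSemidef hd hq, ?_⟩
  rw [iso_eq hd, Matrix.trace_add, Matrix.trace_smul, Matrix.trace_smul, trace_maxEnt hd,
    trace_one_sub_maxEnt hd]
  have := isoTop_add hd q
  simp only [smul_eq_mul, mul_one]
  rw [mul_comm (isoBot d q : ℂ)]
  exact_mod_cast this

/-- Functional calculus of a combination of a projection and its complement. -/
theorem cfc_projection {n : Type*} [Fintype n] [DecidableEq n] {P : Matrix n n ℂ}
    (h : P.IsHermitian) (h2 : P * P = P) (f : ℝ → ℝ) (a b : ℝ) :
    cfc f ((a : ℂ) • P + (b : ℂ) • (1 - P)) = (f a : ℂ) • P + (f b : ℂ) • (1 - P) := by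
  have hP : IsSelfAdjoint P := h
  have hfin : (spectrum ℝ P).Finite := Matrix.finite_real_spectrum
  -- Both sides of the claim are affine functions of `P`, so they need only agree as functions on
  -- the spectrum, which lies in `{0, 1}`. Continuity of `f` is free on a finite set.
  have hlin : ∀ x y : ℝ, cfc (fun t => y + (x - y) * t) P = (x : ℂ) • P + (y : ℂ) • (1 - P) := by
    intro x y
    rw [cfc_const_add y (fun t => (x - y) * t) P, cfc_const_mul_id (x - y) P,
      Algebra.algebraMap_eq_smul_one]
    ext i j
    simp
    ring
  rw [← hlin a b, ← hlin (f a) (f b)]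
  have hc := cfc_comp f (fun t => b + (a - b) * t) P hP
    ((hfin.image _).continuousOn f) (by fun_prop)
  rw [← hc]
  refine cfc_congr fun t ht => ?_
  have : t ∈ ({0, 1} : Set ℝ) := IsIdempotentElem.spectrum_subset ℝ h2 ht
  rcases this with rfl | rfl <;> simp

theorem matLog_iso {d : ℕ} (hd : 2 ≤ d) (q : ℝ) :
    matLog (iso d q) = (Real.logb 2 (isoTop d q) : ℂ) • maxEnt d
      + (Real.logb 2 (isoBot d q) : ℂ) • (1 - maxEnt d) := by
  rw [matLog, iso_eq hd, cfc_projection (maxEnt_isHermitian d) (maxEnt_mul_self hd)]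

theorem trace_iso_mul_matLog_iso {d : ℕ} (hd : 2 ≤ d) (lam q : ℝ) :
    ((iso d lam * matLog (iso d q)).trace).re = isoTop d lam * Real.logb 2 (isoTop d q)
      + (1 - isoTop d lam) * Real.logb 2 (isoBot d q) := by
  have e : iso d lam * matLog (iso d q)
      = ((isoTop d lam * Real.logb 2 (isoTop d q) : ℝ) : ℂ) • maxEnt d
        + ((isoBot d lam * Real.logb 2 (isoBot d q) : ℝ) : ℂ) • (1 - maxEnt d) := by
    rw [matLog_iso hd, iso_eq hd]
    simp only [add_mul, mul_add, smul_mul_smul_comm, mul_sub, sub_mul, maxEnt_mul_self hd, mul_one,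
      one_mul, sub_self, smul_zero, add_zero, zero_add, sub_zero]
    push_cast
    rfl
  have h := isoTop_add hd lam
  rw [e, Matrix.trace_add, Matrix.trace_smul, Matrix.trace_smul, trace_maxEnt hd,
    trace_one_sub_maxEnt hd, show ((d : ℂ) ^ 2 - 1) = (((d : ℝ) ^ 2 - 1 : ℝ) : ℂ) by push_cast; rfl]
  simp only [smul_eq_mul, mul_one, Complex.add_re, Complex.ofReal_re, ← Complex.ofReal_mul]
  linear_combination Real.logb 2 (isoBot d q) * h

theorem entropy_iso {d : ℕ} (hd : 2 ≤ d) (lam : ℝ) :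
    entropy (iso d lam) =
      -((1 + lam * ((d : ℝ) ^ 2 - 1)) / (d : ℝ) ^ 2
          * Real.logb 2 ((1 + lam * ((d : ℝ) ^ 2 - 1)) / (d : ℝ) ^ 2))
        - (1 - lam) * ((d : ℝ) ^ 2 - 1) / (d : ℝ) ^ 2
          * Real.logb 2 ((1 - lam) / (d : ℝ) ^ 2) := by
  rw [entropy, trace_iso_mul_matLog_iso hd]
  have h : 1 - isoTop d lam = (1 - lam) * ((d : ℝ) ^ 2 - 1) / (d : ℝ) ^ 2 := by
    have := isoTop_add hd lam
    rw [isoBot] at this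
    linear_combination -this
  rw [h]
  unfold isoTop isoBot
  ring

/-- Multiplying `iso d q` by `P₊` and by its complement isolates each eigenvalue, so the kernel
condition splits into two scalar ones. -/
theorem isoSupp_mulVec {d : ℕ} (hd : 2 ≤ d) {lam q : ℝ} (h : IsoSupp d lam q)
    (v : Fin d × Fin d → ℂ) (hv : (iso d q).mulVec v = 0) : (iso d lam).mulVec v = 0 := by
  have h2 := two_le_cast hd
  have hP := congrArg (maxEnt d).mulVec hv
  have hQ := congrArg (1 - maxEnt d).mulVec hv
  have eP : maxEnt d * iso d q = (isoTop d q : ℂ) • maxEnt d := by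
    simp [iso_eq hd, mul_add, mul_sub, maxEnt_mul_self hd]
  have eQ : (1 - maxEnt d) * iso d q = (isoBot d q : ℂ) • (1 - maxEnt d) := by
    simp [iso_eq hd, mul_add, mul_sub, sub_mul, maxEnt_mul_self hd]
  rw [Matrix.mulVec_mulVec, eP, Matrix.smul_mulVec, Matrix.mulVec_zero] at hP
  rw [Matrix.mulVec_mulVec, eQ, Matrix.smul_mulVec, Matrix.mulVec_zero] at hQ
  rw [iso_eq hd, Matrix.add_mulVec, Matrix.smul_mulVec, Matrix.smul_mulVec]
  have hb : isoBot d q = 0 → isoBot d lam = 0 := fun h0 => by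
    rw [isoBot_eq hd, h.2 h0, zero_div]
  rcases smul_eq_zero.1 hP with hP | hP <;> rcases smul_eq_zero.1 hQ with hQ | hQ
  · simp [h.1 (by exact_mod_cast hP), hb (by exact_mod_cast hQ)]
  · simp [h.1 (by exact_mod_cast hP), hQ]
  · simp [hP, hb (by exact_mod_cast hQ)]
  · simp [hP, hQ]

/-! ### Comparison of the entropy terms at equal overlap -/

/-- The overlap of `σ` with the maximally entangled state. -/
noncomputable def fidelity {d : ℕ} (σ : Op d) : ℝ := ((maxEnt d * σ).trace).re

theorem iso_trace_matLog_le {d : ℕ} (hd : 2 ≤ d) {lam : ℝ} (hlam : lam ∈ isoRange d) {σ : Op d}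
    (hσ : IsState σ)
    (hsupp : ∀ v : Fin d × Fin d → ℂ, σ.mulVec v = 0 → (iso d lam).mulVec v = 0)
    {q : ℝ} (hq : isoTop d q = fidelity σ) :
    IsoSupp d lam q ∧ ((iso d lam * matLog σ).trace).re ≤
      isoTop d lam * Real.logb 2 (isoTop d q) + (1 - isoTop d lam) * Real.logb 2 (isoBot d q) := by
  have h2 := two_le_cast hd
  have hD : (0 : ℝ) < (d : ℝ) ^ 2 - 1 := by nlinarith
  have hH := hσ.1.isHermitian
  set U : Op d := hH.eigenvectorUnitary.1 with hU
  set s := hH.eigenvalues with hs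
  have hUU : star U * U = 1 := Unitary.coe_star_mul_self _
  have hUU' : U * star U = 1 := Unitary.coe_mul_star_self _
  have hdec : ∀ f : ℝ → ℝ, cfc f σ = U * Matrix.diagonal (fun i => ((f (s i) : ℝ) : ℂ)) * star U := by
    intro f
    rw [hH.cfc_eq, Matrix.IsHermitian.cfc, Unitary.conjStarAlgAut_apply]
    rfl
  have hself : σ = U * Matrix.diagonal (fun i => ((s i : ℝ) : ℂ)) * star U := by
    conv_lhs => rw [← cfc_id' ℝ σ hH.isSelfAdjoint]
    exact hdec _
  -- In the eigenbasis of `σ` only the diagonal entries of `X` contribute; for `X = P₊` they are the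
  -- Jensen weights `w`.
  have htr : ∀ (X : Op d) (f : ℝ → ℝ), ((X * cfc f σ).trace).re =
      ∑ i, ((star U * X * U) i i).re * f (s i) := by
    intro X f
    rw [hdec, ← mul_assoc, Matrix.trace_mul_comm, ← mul_assoc, ← mul_assoc]
    simp [Matrix.trace, Matrix.mul_diagonal]
  set w : Fin d × Fin d → ℝ := fun i => ((star U * maxEnt d * U) i i).re with hw
  have hw1 : ∀ i, ((star U * (1 - maxEnt d) * U) i i).re = 1 - w i := by
    intro i
    simp [hw, mul_sub, sub_mul, hUU]
  have hw0 : ∀ i, 0 ≤ w i := fun i => by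
    have := ((maxEnt_posSemidef hd).conjTranspose_mul_mul_same U).diag_nonneg (i := i)
    exact (Complex.le_def.1 this).1
  have hw0' : ∀ i, 0 ≤ 1 - w i := fun i => by
    have := ((one_sub_maxEnt_posSemidef hd).conjTranspose_mul_mul_same U).diag_nonneg (i := i)
    rw [← hw1]
    exact (Complex.le_def.1 this).1
  have hs0 : ∀ i, 0 ≤ s i := fun i => hσ.1.eigenvalues_nonneg i
  have hsumw : ∑ i, w i = 1 := by
    have : (star U * maxEnt d * U).trace = 1 := by
      rw [Matrix.trace_mul_comm, ← mul_assoc, hUU', one_mul, trace_maxEnt hd]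
    have := congrArg Complex.re this
    simpa [Matrix.trace] using this
  have hcard : ∑ i : Fin d × Fin d, (1 : ℝ) = (d : ℝ) ^ 2 := by simp [sq]
  have hf : ∑ i, w i * s i = 1 * isoTop d q := by
    rw [hq, fidelity, one_mul]
    conv_rhs => rw [← cfc_id' ℝ σ hH.isSelfAdjoint]
    rw [htr]
  have hss : ∑ i, s i = 1 := by
    have := htr 1 (fun x => x)
    rw [cfc_id' ℝ σ hH.isSelfAdjoint, one_mul, hσ.2] at this
    simpa [hUU] using this.symm
  have hr : ∀ i, ((star U * iso d lam * U) i i).re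
      = isoTop d lam * w i + isoBot d lam * (1 - w i) := by
    intro i
    rw [← hw1, iso_eq hd, mul_add, add_mul]
    simp [hw]
  have hA := isoTop_nonneg hd hlam
  have hB := isoBot_nonneg hlam
  -- An eigenvector in the kernel of `σ` lies in that of `ρ`, so the diagonal entry of `ρ` there is
  -- zero, and with it both of its nonnegative summands. This is the vanishing-weight hypothesis of
  -- Jensen.
  have hker : ∀ i, s i = 0 → isoTop d lam * w i = 0 ∧ isoBot d lam * (1 - w i) = 0 := by
    intro i hi
    have h0 : σ.mulVec (U.mulVec (Pi.single i 1)) = 0 := by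
      rw [hU, hH.eigenvectorUnitary_mulVec, hH.mulVec_eigenvectorBasis, ← hs, hi, zero_smul]
    have h1 := hsupp _ h0
    have h3 := hr i
    have h4 : (star U * iso d lam * U) i i = 0 := by
      have : (star U * iso d lam * U).mulVec (Pi.single i 1) = 0 := by
        rw [← Matrix.mulVec_mulVec, ← Matrix.mulVec_mulVec, h1, Matrix.mulVec_zero]
      have := congrFun this i
      simpa using this
    rw [h4, Complex.zero_re] at h3
    have h5 := mul_nonneg hA (hw0 i)
    have h6 := mul_nonneg hB (hw0' i)
    constructor <;> linarith
  have hB1 : 1 - isoTop d lam = ((d : ℝ) ^ 2 - 1) * isoBot d lam := by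
    linarith [isoTop_add hd lam]
  have hBq : ∑ i, (1 - w i) * s i = ((d : ℝ) ^ 2 - 1) * isoBot d q := by
    have : ∑ i, (1 - w i) * s i = ∑ i, s i - ∑ i, w i * s i := by
      rw [← Finset.sum_sub_distrib]
      exact Finset.sum_congr rfl fun i _ => by ring
    rw [this, hf, hss]
    linarith [isoTop_add hd q]
  have hsumw' : ∑ i, (1 - w i) = (d : ℝ) ^ 2 - 1 := by
    rw [Finset.sum_sub_distrib, hsumw, hcard]
  refine ⟨⟨fun h0 => ?_, fun h0 => ?_⟩, ?_⟩
  -- If the overlap is zero, each `w i` or `s i` vanishes; either way `isoTop d lam * w i = 0`, and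
  -- the `w i` sum to 1. The other eigenvalue is treated alike with `1 - w i`.
  · rw [h0, mul_zero] at hf
    have hz : ∀ i, w i * s i = 0 := fun i =>
      (Finset.sum_eq_zero_iff_of_nonneg fun i _ => mul_nonneg (hw0 i) (hs0 i)).1 hf i
        (Finset.mem_univ i)
    have : ∀ i, isoTop d lam * w i = 0 := fun i => (mul_eq_zero.1 (hz i)).elim
      (fun h => by rw [h, mul_zero]) (fun h => (hker i h).1)
    rw [← mul_one (isoTop d lam), ← hsumw, Finset.mul_sum]
    exact Finset.sum_eq_zero fun i _ => this i
  · rw [h0, mul_zero] at hBq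
    have hz : ∀ i, (1 - w i) * s i = 0 := fun i =>
      (Finset.sum_eq_zero_iff_of_nonneg fun i _ => mul_nonneg (hw0' i) (hs0 i)).1 hBq i
        (Finset.mem_univ i)
    have : ∀ i, isoBot d lam * (1 - w i) = 0 := fun i => (mul_eq_zero.1 (hz i)).elim
      (fun h => by rw [h, mul_zero]) (fun h => (hker i h).2)
    rw [hB1, ← hsumw', mul_comm, Finset.mul_sum]
    exact Finset.sum_eq_zero fun i _ => this i
  · rw [matLog, htr]
    simp only [hr, add_mul, Finset.sum_add_distrib]
    refine add_le_add ?_ ?_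
    · simp only [mul_assoc, ← Finset.mul_sum]
      by_cases h0 : isoTop d lam = 0
      · simp [h0]
      refine mul_le_mul_of_nonneg_left ?_ hA
      simpa using sum_mul_logb_le w s hw0 hs0
        (fun i hi => (mul_eq_zero.1 (hker i hi).1).resolve_left h0) hsumw hf
    · rw [hB1]
      simp only [mul_assoc, ← Finset.mul_sum]
      rw [mul_left_comm]
      by_cases h0 : isoBot d lam = 0
      · simp [h0]
      refine mul_le_mul_of_nonneg_left ?_ hB
      exact sum_mul_logb_le (fun i => 1 - w i) s hw0' hs0
        (fun i hi => (mul_eq_zero.1 (hker i hi).2).resolve_left h0) hsumw' hBq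

/-! ### Norm of the partial transpose -/

/-- The swap operator `|i⟩ ⊗ |j⟩ ↦ |j⟩ ⊗ |i⟩`. -/
def swapOp (d : ℕ) : Op d :=
  Matrix.of fun a b => if a.1 = b.2 ∧ b.1 = a.2 then 1 else 0

theorem swapOp_mul_self (d : ℕ) : swapOp d * swapOp d = 1 := by
  ext a b
  simp [swapOp, Matrix.mul_apply, Fintype.sum_prod_type, Matrix.one_apply, Prod.ext_iff, ite_and]
  grind

theorem swapOp_conjTranspose (d : ℕ) : (swapOp d).conjTranspose = swapOp d := by
  ext a b
  simp [swapOp, Matrix.conjTranspose_apply, apply_ite (starRingEnd ℂ)]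
  grind

theorem trace_swapOp (d : ℕ) : (swapOp d).trace = d := by
  have h : ∀ a, (swapOp d).diag a = if a.1 = a.2 then 1 else 0 := by simp [swapOp]
  simp only [Matrix.trace, h, Fintype.sum_prod_type]
  simp

theorem partialTranspose_iso {d : ℕ} (q : ℝ) :
    partialTranspose (iso d q) = ((q / d : ℝ) : ℂ) • swapOp d + (isoBot d q : ℂ) • (1 : Op d) := by
  ext a b
  simp [partialTranspose, iso, maxEnt, swapOp, isoBot, Matrix.one_apply, Prod.ext_iff,
    div_eq_mul_inv]
  grind

theorem trace_partialTranspose {d : ℕ} (A : Op d) : (partialTranspose A).trace = A.trace := rfl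

/-- `Γ` is symmetric for the trace pairing and exchanges the swap with `d P₊`. Thus the overlap can
be read off from `σ^Γ`. -/
theorem trace_swapOp_mul_partialTranspose {d : ℕ} (hd : 2 ≤ d) (A : Op d) :
    (swapOp d * partialTranspose A).trace = d * (maxEnt d * A).trace := by
  have h0 : (d : ℂ) ≠ 0 := by exact_mod_cast (by omega : d ≠ 0)
  simp [swapOp, partialTranspose, maxEnt, Matrix.trace, Matrix.mul_apply, Fintype.sum_prod_type,
    ite_and, Finset.mul_sum, h0]

theorem opNorm_swapOp_le {d : ℕ} (hd : 2 ≤ d) : opNorm (swapOp d) ≤ 1 := by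
  have : Nonempty (Fin d × Fin d) := ⟨(⟨0, by omega⟩, ⟨0, by omega⟩)⟩
  have hu : swapOp d ∈ unitary (Op d) := by
    rw [Unitary.mem_iff, Matrix.star_eq_conjTranspose, swapOp_conjTranspose]
    exact ⟨swapOp_mul_self d, swapOp_mul_self d⟩
  exact (CStarRing.norm_of_mem_unitary
    (Unitary.map_mem (Matrix.toEuclideanCLM (n := Fin d × Fin d) (𝕜 := ℂ)) hu)).le

theorem opNorm_partialTranspose_iso_le {d : ℕ} (hd : 2 ≤ d) {q : ℝ} (hq : q ∈ isoRange d) :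
    opNorm (partialTranspose (iso d q)) ≤ isoNorm d q := by
  have : Nonempty (Fin d × Fin d) := ⟨(⟨0, by omega⟩, ⟨0, by omega⟩)⟩
  rw [partialTranspose_iso, opNorm, map_add, map_smul, map_smul, map_one]
  refine (norm_add_le _ _).trans ?_
  rw [norm_smul, norm_smul, norm_one, mul_one, isoNorm, add_comm]
  refine add_le_add (by simp [abs_of_nonneg (isoBot_nonneg hq)]) ?_
  calc _ ≤ ‖((q / d : ℝ) : ℂ)‖ * 1 :=
        mul_le_mul_of_nonneg_left (opNorm_swapOp_le hd) (norm_nonneg _)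
    _ = |q| / d := by simp

/-- The trace is a sum of `⟨v, X v⟩` over the columns `v` of `V`, and each term has real part at
most `‖X‖ ‖v‖²`. -/
theorem re_trace_conj_le {d : ℕ} (X V : Op d) :
    ((V.conjTranspose * X * V).trace).re ≤ opNorm X * ((V.conjTranspose * V).trace).re := by
  simp only [Matrix.trace, Complex.re_sum, Finset.mul_sum]
  refine Finset.sum_le_sum fun k _ => ?_
  set v : EuclideanSpace ℂ (Fin d × Fin d) := WithLp.toLp 2 (fun i => V i k) with hv
  have h1 : (V.conjTranspose * X * V).diag k
      = inner ℂ v (Matrix.toEuclideanCLM (n := Fin d × Fin d) (𝕜 := ℂ) X v) := by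
    rw [EuclideanSpace.inner_eq_star_dotProduct, Matrix.ofLp_toEuclideanCLM, dotProduct_comm,
      mul_assoc]
    rfl
  have h2 : (V.conjTranspose * V).diag k = inner ℂ v v := by
    rw [EuclideanSpace.inner_eq_star_dotProduct, dotProduct_comm]
    rfl
  rw [h1, h2]
  have h3 : (inner ℂ v v : ℂ).re = ‖v‖ ^ 2 := inner_self_eq_norm_sq (𝕜 := ℂ) v
  rw [h3]
  refine (Complex.re_le_norm _).trans ((norm_inner_le_norm _ _).trans ?_)
  have := (Matrix.toEuclideanCLM (n := Fin d × Fin d) (𝕜 := ℂ) X).le_opNorm v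
  calc _ ≤ ‖v‖ * (opNorm X * ‖v‖) := mul_le_mul_of_nonneg_left this (norm_nonneg _)
    _ = opNorm X * ‖v‖ ^ 2 := by ring

theorem fidelity_le_opNorm {d : ℕ} (hd : 2 ≤ d) {σ : Op d} (hσ : σ.trace = 1) (ε : ℝ)
    (hε : ε * ε = 1) :
    1 + ε * (d * fidelity σ) ≤ opNorm (partialTranspose σ) * ((d : ℝ) ^ 2 + ε * d) := by
  -- For `ε = ±1` this is twice the projection onto the symmetric or antisymmetric subspace, so `V†
  -- X V` and `V† V` have traces `2 tr(V X)` and `2 tr V`.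
  set V : Op d := 1 + (ε : ℂ) • swapOp d with hV
  have hεc : (ε : ℂ) * ε = 1 := by exact_mod_cast hε
  have hVs : V.conjTranspose = V := by
    simp [hV, Matrix.conjTranspose_add, Matrix.conjTranspose_smul, swapOp_conjTranspose]
  have hVV : V * V = (2 : ℂ) • V := by
    simp only [hV, mul_add, add_mul, one_mul, mul_one, smul_mul_smul_comm, swapOp_mul_self, hεc]
    module
  have h := re_trace_conj_le (partialTranspose σ) V
  rw [hVs, Matrix.trace_mul_comm, ← mul_assoc, hVV, Matrix.smul_mul, Matrix.trace_smul,
    Matrix.trace_smul, hV, add_mul, one_mul, Matrix.smul_mul, Matrix.trace_add, Matrix.trace_add,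
    Matrix.trace_smul, Matrix.trace_smul, trace_swapOp_mul_partialTranspose hd,
    trace_partialTranspose, hσ, trace_swapOp, Matrix.trace_one] at h
  simp at h
  rw [← fidelity] at h
  nlinarith

theorem isoNorm_le_opNorm {d : ℕ} (hd : 2 ≤ d) {σ : Op d} (hσ : σ.trace = 1) {q : ℝ}
    (hq : isoTop d q = fidelity σ) : isoNorm d q ≤ opNorm (partialTranspose σ) := by
  have h2 := two_le_cast hd
  have h0 : (0 : ℝ) < d := by linarith
  -- The norm of the partial transpose of `iso d q` is attained on the symmetric subspace for `q ≥
  -- 0` and on the antisymmetric one for `q ≤ 0`; the sign is chosen to match.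
  rcases le_total 0 q with hs | hs
  · have h := fidelity_le_opNorm hd hσ 1 (by norm_num)
    rw [← hq] at h
    have e : 1 + 1 * (d * isoTop d q) = isoNorm d q * ((d : ℝ) ^ 2 + 1 * d) := by
      rw [isoNorm_of_nonneg hd hs, isoTop]
      field_simp
      ring
    rw [e] at h
    exact le_of_mul_le_mul_right h (by positivity)
  · have h := fidelity_le_opNorm hd hσ (-1) (by norm_num)
    rw [← hq] at h
    have e : 1 + (-1) * (d * isoTop d q) = isoNorm d q * ((d : ℝ) ^ 2 + (-1) * d) := by
      rw [isoNorm, abs_of_nonpos hs, isoTop, isoBot]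
      field_simp
      ring
    rw [e] at h
    exact le_of_mul_le_mul_right h (by nlinarith)

theorem fidelity_iso {d : ℕ} (hd : 2 ≤ d) (q : ℝ) : fidelity (iso d q) = isoTop d q := by
  rw [fidelity, iso_eq hd]
  simp [mul_add, mul_sub, maxEnt_mul_self hd, trace_maxEnt hd]

theorem opNorm_partialTranspose_iso {d : ℕ} (hd : 2 ≤ d) {q : ℝ} (hq : q ∈ isoRange d) :
    opNorm (partialTranspose (iso d q)) = isoNorm d q :=
  (opNorm_partialTranspose_iso_le hd hq).antisymm
    (isoNorm_le_opNorm hd (isState_iso hd hq).2 (fidelity_iso hd q).symm)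

/-! ### The twirl and its invariants -/

theorem conjPair_mul {d : ℕ} (U V : Matrix.unitaryGroup (Fin d) ℂ) :
    conjPair (U * V) = conjPair U * conjPair V := by
  have h : ((U : Matrix (Fin d) (Fin d) ℂ) * V).map star
      = (U : Matrix (Fin d) (Fin d) ℂ).map star * (V : Matrix (Fin d) (Fin d) ℂ).map star :=
    Matrix.map_mul (f := starRingEnd ℂ)
  unfold conjPair
  rw [← Matrix.mul_kronecker_mul, ← h]
  rfl

theorem conjPair_one {d : ℕ} : conjPair (1 : Matrix.unitaryGroup (Fin d) ℂ) = 1 := by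
  ext a b
  simp only [conjPair, OneMemClass.coe_one, Matrix.kroneckerMap_apply, Matrix.map_apply,
    Matrix.one_apply, Prod.ext_iff]
  by_cases h1 : a.1 = b.1 <;> by_cases h2 : a.2 = b.2 <;> simp [h1, h2]

theorem conjPair_inv {d : ℕ} (U : Matrix.unitaryGroup (Fin d) ℂ) :
    conjPair U⁻¹ = (conjPair U).conjTranspose := by
  ext a b
  simp [conjPair, Matrix.conjTranspose_apply, Matrix.star_apply]

theorem conjPair_conjTranspose_mul {d : ℕ} (U : Matrix.unitaryGroup (Fin d) ℂ) :
    (conjPair U).conjTranspose * conjPair U = 1 := by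
  rw [← conjPair_inv, ← conjPair_mul, inv_mul_cancel, conjPair_one]

theorem conjPair_mul_conjTranspose {d : ℕ} (U : Matrix.unitaryGroup (Fin d) ℂ) :
    conjPair U * (conjPair U).conjTranspose = 1 := by
  rw [← conjPair_inv, ← conjPair_mul, mul_inv_cancel, conjPair_one]

/-- `U ⊗ U*` fixes `∑ᵢ |i⟩ ⊗ |i⟩` because the rows of `U` are orthonormal. -/
theorem conjPair_mul_maxEnt {d : ℕ} (U : Matrix.unitaryGroup (Fin d) ℂ) :
    conjPair U * maxEnt d = maxEnt d := by
  ext a b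
  have h := congrFun (congrFun (Matrix.mem_unitaryGroup_iff.1 U.2) a.1) a.2
  simp only [Matrix.mul_apply, Matrix.star_apply] at h
  by_cases hb : b.1 = b.2
  · simp only [Matrix.mul_apply, conjPair, maxEnt, Matrix.of_apply, Fintype.sum_prod_type, hb,
      and_true, Matrix.kroneckerMap_apply, Matrix.map_apply, mul_ite, mul_zero,
      Finset.sum_ite_eq, Finset.mem_univ, if_true, ← Finset.sum_mul]
    rw [h, Matrix.one_apply, ite_mul, one_mul, zero_mul]
  · simp [Matrix.mul_apply, maxEnt, hb]

theorem maxEnt_mul_conjPair {d : ℕ} (U : Matrix.unitaryGroup (Fin d) ℂ) :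
    maxEnt d * conjPair U = maxEnt d := by
  have h := congrArg Matrix.conjTranspose (conjPair_mul_maxEnt U⁻¹)
  rwa [Matrix.conjTranspose_mul, conjPair_inv, Matrix.conjTranspose_conjTranspose,
    (maxEnt_isHermitian d).eq] at h

theorem continuous_conjPair (d : ℕ) :
    Continuous (conjPair : Matrix.unitaryGroup (Fin d) ℂ → Op d) := by
  refine continuous_matrix fun a b => ?_
  have h : ∀ i j, Continuous fun U : Matrix.unitaryGroup (Fin d) ℂ =>
      (U : Matrix (Fin d) (Fin d) ℂ) i j := fun i j => continuous_subtype_val.matrix_elem i j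
  exact (h a.1 b.1).mul (h a.2 b.2).star

instance instProbHaar (d : ℕ) : MeasureTheory.IsProbabilityMeasure (haarU d) :=
  ⟨MeasureTheory.Measure.haarMeasure_self⟩

instance instInvHaar (d : ℕ) : (haarU d).IsMulLeftInvariant := by
  unfold haarU
  infer_instance

theorem continuous_conj {d : ℕ} (σ : Op d) :
    Continuous fun U : Matrix.unitaryGroup (Fin d) ℂ =>
      conjPair U * σ * (conjPair U).conjTranspose :=
  ((continuous_conjPair d).mul continuous_const).mul (continuous_conjPair d).matrix_conjTranspose

theorem integrable_conj_apply {d : ℕ} (σ : Op d) (a b : Fin d × Fin d) :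
    MeasureTheory.Integrable (fun U : Matrix.unitaryGroup (Fin d) ℂ =>
      (conjPair U * σ * (conjPair U).conjTranspose) a b) (haarU d) :=
  ((continuous_conj σ).matrix_elem a b).integrable_of_hasCompactSupport
    (HasCompactSupport.of_compactSpace _)

theorem trace_mul_twirl {d : ℕ} (B σ : Op d) :
    (B * twirl σ).trace = ∫ U : Matrix.unitaryGroup (Fin d) ℂ,
      (B * (conjPair U * σ * (conjPair U).conjTranspose)).trace ∂(haarU d) := by
  simp only [Matrix.trace, Matrix.diag_apply, Matrix.mul_apply (M := B)]
  rw [MeasureTheory.integral_finsetSum]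
  · refine Finset.sum_congr rfl fun a _ => ?_
    rw [MeasureTheory.integral_finsetSum]
    · refine Finset.sum_congr rfl fun b _ => ?_
      rw [MeasureTheory.integral_const_mul]
      rfl
    · exact fun b _ => (integrable_conj_apply σ b a).const_mul _
  · exact fun a _ => MeasureTheory.integrable_finsetSum _ fun b _ =>
      (integrable_conj_apply σ b a).const_mul _

theorem trace_twirl {d : ℕ} (σ : Op d) : (twirl σ).trace = σ.trace := by
  have h := trace_mul_twirl 1 σ
  simp only [one_mul] at h
  rw [h]
  simp [Matrix.trace_mul_comm, ← mul_assoc, conjPair_conjTranspose_mul]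

theorem trace_maxEnt_mul_twirl {d : ℕ} (σ : Op d) :
    (maxEnt d * twirl σ).trace = (maxEnt d * σ).trace := by
  rw [trace_mul_twirl]
  have h : ∀ U : Matrix.unitaryGroup (Fin d) ℂ,
      (maxEnt d * (conjPair U * σ * (conjPair U).conjTranspose)).trace
        = (maxEnt d * σ).trace := fun U => by
    rw [← mul_assoc, ← mul_assoc, maxEnt_mul_conjPair, Matrix.trace_mul_comm, ← mul_assoc,
      ← conjPair_inv, conjPair_mul_maxEnt]
  simp [h]

theorem conj_twirl {d : ℕ} (σ : Op d) (V : Matrix.unitaryGroup (Fin d) ℂ) :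
    conjPair V * twirl σ * (conjPair V).conjTranspose = twirl σ := by
  ext a b
  -- Writing an entry as a trace against a matrix unit lets the conjugation by `V` pass under the
  -- integral, where left invariance of Haar measure absorbs it.
  have h1 : ∀ X : Op d, X a b = (Matrix.single b a 1 * X).trace := fun X => by
    rw [Matrix.trace_single_mul, one_smul]
  have h2 : ∀ X : Op d, (Matrix.single b a 1 * (conjPair V * X * (conjPair V).conjTranspose)).trace
      = ((conjPair V).conjTranspose * Matrix.single b a 1 * conjPair V * X).trace := fun X => by
    rw [← mul_assoc, ← mul_assoc, Matrix.trace_mul_comm, ← mul_assoc, ← mul_assoc]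
  rw [h1 (conjPair V * twirl σ * _), h2, trace_mul_twirl]
  simp only [← h2, ← h1]
  refine Eq.trans ?_ (MeasureTheory.integral_mul_left_eq_self
    (fun U => (conjPair U * σ * (conjPair U).conjTranspose) a b) V)
  refine MeasureTheory.integral_congr_ae (Filter.Eventually.of_forall fun U => ?_)
  simp only [conjPair_mul, Matrix.conjTranspose_mul, mul_assoc]

/-! ### Operators invariant under every `U ⊗ U*` -/

theorem conj_apply {d : ℕ} (T : Op d) (V : Matrix.unitaryGroup (Fin d) ℂ) (i j k l : Fin d) :
    (conjPair V * T * (conjPair V).conjTranspose) (i, j) (k, l) =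
      ∑ k', ∑ l', (∑ i', ∑ j', V.1 i i' * star (V.1 j j') * T (i', j') (k', l'))
        * (star (V.1 k k') * V.1 l l') := by
  simp [Matrix.mul_apply, conjPair, Fintype.sum_prod_type, Matrix.conjTranspose_apply, mul_comm]

/-- The unitary that permutes the basis by `π` and multiplies it by the phases `v`. -/
def monomialUnitary {d : ℕ} (π : Equiv.Perm (Fin d)) (v : Fin d → ℂ)
    (hv : ∀ i, v i * star (v i) = 1) : Matrix.unitaryGroup (Fin d) ℂ :=
  ⟨Matrix.of fun i i' => if i' = π i then v i else 0, by
    rw [Matrix.mem_unitaryGroup_iff]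
    ext i j
    by_cases h : i = j
    · subst h
      simpa [Matrix.mul_apply, Matrix.star_apply] using hv i
    · simp [Matrix.mul_apply, Matrix.star_apply, h]⟩

theorem apply_of_invariant_monomial {d : ℕ} {T : Op d}
    (hT : ∀ V, conjPair V * T * (conjPair V).conjTranspose = T)
    (π : Equiv.Perm (Fin d)) (v : Fin d → ℂ) (hv : ∀ i, v i * star (v i) = 1) (i j k l : Fin d) :
    T (i, j) (k, l) =
      v i * star (v j) * T (π i, π j) (π k, π l) * (star (v k) * v l) := by
  conv_lhs => rw [← hT (monomialUnitary π v hv), conj_apply]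
  simp [monomialUnitary, apply_ite (starRingEnd ℂ)]

/-- The phase `I` at a single index multiplies the entry by `v i * star (v j) * star (v k) * v l`.
Under `h1` and `h2` the index can be chosen so that this factor is `I` or `-1`, never 1. -/
theorem apply_eq_zero_of_invariant {d : ℕ} {T : Op d}
    (hT : ∀ V, conjPair V * T * (conjPair V).conjTranspose = T)
    {i j k l : Fin d} (h1 : ¬(i = j ∧ k = l)) (h2 : ¬(i = k ∧ j = l)) : T (i, j) (k, l) = 0 := by
  have key : ∀ m : Fin d, T (i, j) (k, l) = _ := fun m =>
    apply_of_invariant_monomial hT 1 (fun x => if x = m then Complex.I else 1)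
      (fun x => by by_cases hx : x = m <;> simp [hx]) i j k l
  have hI : (Complex.I - 1) ≠ 0 := fun h => by simpa using congrArg Complex.re h
  have hs : ∀ z : ℂ, z = Complex.I * z → z = 0 := fun z hz => by
    have : (Complex.I - 1) * z = 0 := by rw [sub_mul, ← hz, one_mul, sub_self]
    exact (mul_eq_zero.1 this).resolve_left hI
  have hs' : ∀ z : ℂ, z = -z → z = 0 := fun z hz => self_eq_neg.1 hz
  by_cases hij : i = j
  · have hkl : k ≠ l := fun h => h1 ⟨hij, h⟩
    have h := key l
    subst hij
    by_cases hil : i = l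
    · subst hil
      apply hs
      simpa [hkl, mul_comm] using h
    · apply hs
      simpa [hkl, hil, mul_comm] using h
  · by_cases hik : i = k
    · have hjl : j ≠ l := fun h => h2 ⟨hik, h⟩
      have h := key l
      subst hik
      by_cases hil : i = l
      · subst hil
        apply hs
        simpa [hjl, mul_comm] using h
      · apply hs
        simpa [hjl, hil, mul_comm] using h
    · have h := key i
      by_cases hil : i = l
      · subst hil
        apply hs'
        have e : ∀ z : ℂ, Complex.I * z * Complex.I = -z := fun z => by
          rw [mul_right_comm, Complex.I_mul_I]; ring
        simpa [Ne.symm hij, Ne.symm hik, e] using h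
      · apply hs
        simpa [Ne.symm hij, Ne.symm hik, Ne.symm hil] using h

/-- A reflection whose rows `m ≠ n` have overlapping supports. -/
theorem exists_unitary_rows_overlap {d : ℕ} {m n : Fin d} (hmn : m ≠ n) :
    ∃ V : Matrix.unitaryGroup (Fin d) ℂ,
      ∑ i, V.1 m i * star (V.1 m i) * (star (V.1 n i) * V.1 n i) ≠ 0 := by
  set u : Fin d → ℂ := fun i => if i = m then 3 / 5 else if i = n then 4 / 5 else 0 with hu
  have hus : ∀ i, star (u i) = u i := fun i => by
    by_cases h : i = m <;> by_cases h' : i = n <;> simp [hu, h, h', hmn.symm]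
  have huu : ∑ i, u i * u i = 1 := by
    have : ∀ i, u i * u i = (if i = m then 9 / 25 else 0) + (if i = n then 16 / 25 else 0) := by
      intro i
      by_cases h : i = m
      · subst h; simp [hu, hmn]; norm_num
      · by_cases h' : i = n <;> simp [hu, h, h', hmn.symm]; norm_num
    simp only [this, Finset.sum_add_distrib, Finset.sum_ite_eq', Finset.mem_univ, if_true]
    norm_num
  set Q : Matrix (Fin d) (Fin d) ℂ := Matrix.vecMulVec u u with hQ
  have hQQ : Q * Q = Q := by
    rw [hQ, Matrix.vecMulVec_mul_vecMulVec]
    simp [dotProduct, huu]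
  have hQs : star Q = Q := by
    ext i j
    simp only [Matrix.star_apply, hQ, Matrix.vecMulVec_apply, star_mul', hus, mul_comm]
  have hV : (1 - (2 : ℂ) • Q) ∈ Matrix.unitaryGroup (Fin d) ℂ := by
    rw [Matrix.mem_unitaryGroup_iff, star_sub, star_one, star_smul, hQs]
    simp only [mul_sub, sub_mul, mul_one, one_mul, smul_mul_smul_comm, hQQ]
    rw [show star (2 : ℂ) = 2 by simp]
    module
  refine ⟨⟨_, hV⟩, fun h0 => ?_⟩
  have hre : ∀ z w : ℂ, z * star z * (star w * w) = ((Complex.normSq z * Complex.normSq w : ℝ) : ℂ) := by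
    intro z w
    push_cast
    rw [← Complex.mul_conj, ← Complex.mul_conj]
    simp [mul_comm]
  simp only [hre] at h0
  rw [← Complex.ofReal_sum, Complex.ofReal_eq_zero, Finset.sum_eq_zero_iff_of_nonneg
    fun i _ => mul_nonneg (Complex.normSq_nonneg _) (Complex.normSq_nonneg _)] at h0
  have h := h0 m (Finset.mem_univ m)
  rw [mul_eq_zero, Complex.normSq_eq_zero, Complex.normSq_eq_zero] at h
  rcases h with h | h
  · simp [hQ, Matrix.vecMulVec_apply, hu] at h
    norm_num at h
  · simp [hQ, Matrix.vecMulVec_apply, hu, hmn.symm] at h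

/-- Phases leave only the entries `(ii, kk)` and `(ij, ij)`, and two-transitivity of the
permutations makes each kind constant off `i = k`, respectively `i = j`. What could remain besides
`P₊` and `I` is `γ ∑ᵢ |ii⟩⟨ii|`, which monomial unitaries preserve; a reflection with overlapping
rows forces `γ = 0`. -/
theorem exists_of_invariant {d : ℕ} (hd : 2 ≤ d) {T : Op d}
    (hT : ∀ V, conjPair V * T * (conjPair V).conjTranspose = T) :
    ∃ α β : ℂ, T = α • maxEnt d + β • (1 : Op d) := by
  have h0 : (d : ℂ) ≠ 0 := by exact_mod_cast (by omega : d ≠ 0)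
  set m : Fin d := ⟨0, by omega⟩
  set n : Fin d := ⟨1, by omega⟩
  have hmn : m ≠ n := by simp [m, n]
  have hperm : ∀ (π : Equiv.Perm (Fin d)) (i j k l : Fin d),
      T (i, j) (k, l) = T (π i, π j) (π k, π l) := fun π i j k l => by
    simpa using apply_of_invariant_monomial hT π (fun _ => 1) (by simp) i j k l
  have htwo : ∀ i k : Fin d, i ≠ k → ∃ π : Equiv.Perm (Fin d), π i = m ∧ π k = n :=
    fun i k hik => (MulAction.is_two_pretransitive_iff (G := Equiv.Perm (Fin d))).1
      (Equiv.Perm.isMultiplyPretransitive (Fin d) 2) hik hmn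
  set γ := T (m, m) (m, m) - T (m, m) (n, n) - T (m, n) (m, n) with hγ
  have hdiag : T - ((d * T (m, m) (n, n)) • maxEnt d + T (m, n) (m, n) • (1 : Op d))
      = Matrix.diagonal fun a => if a.1 = a.2 then γ else 0 := by
    ext ⟨i, j⟩ ⟨k, l⟩
    have e1 : i ≠ k → T (i, i) (k, k) = T (m, m) (n, n) := fun h => by
      obtain ⟨π, hi, hk⟩ := htwo i k h
      rw [hperm π, hi, hk]
    have e2 : i ≠ j → T (i, j) (i, j) = T (m, n) (m, n) := fun h => by
      obtain ⟨π, hi, hk⟩ := htwo i j h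
      rw [hperm π, hi, hk]
    have e3 : T (i, i) (i, i) = T (m, m) (m, m) := by
      rw [hperm (Equiv.swap i m), Equiv.swap_apply_left]
    have e4 : ¬(i = j ∧ k = l) → ¬(i = k ∧ j = l) → T (i, j) (k, l) = 0 :=
      apply_eq_zero_of_invariant hT
    by_cases hij : i = j ∧ k = l
    · obtain ⟨rfl, rfl⟩ := hij
      by_cases hik : i = k
      · subst hik
        simp [maxEnt, h0, e3, hγ, mul_right_comm]
        ring
      · simp [maxEnt, h0, e1 hik, hik, mul_right_comm]
    · by_cases hik : i = k ∧ j = l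
      · obtain ⟨rfl, rfl⟩ := hik
        have : i ≠ j := fun h => hij ⟨h, h⟩
        simp [maxEnt, this, e2 this]
      · have hne : ((i, j) : Fin d × Fin d) ≠ (k, l) := by simpa [Prod.ext_iff] using hik
        rw [Matrix.diagonal_apply_ne _ hne]
        simp [maxEnt, hij, e4 hij hik, Matrix.one_apply_ne hne]
  have hinv : ∀ V, conjPair V * (T - ((d * T (m, m) (n, n)) • maxEnt d
      + T (m, n) (m, n) • (1 : Op d))) * (conjPair V).conjTranspose
      = T - ((d * T (m, m) (n, n)) • maxEnt d + T (m, n) (m, n) • (1 : Op d)) := fun V => by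
    have hP : maxEnt d * (conjPair V).conjTranspose = maxEnt d := by
      rw [← conjPair_inv, maxEnt_mul_conjPair]
    rw [mul_sub, sub_mul, hT V, mul_add, add_mul, Matrix.mul_smul, Matrix.smul_mul,
      Matrix.mul_smul, Matrix.smul_mul, conjPair_mul_maxEnt, hP, mul_one,
      conjPair_mul_conjTranspose]
  rw [hdiag] at hinv
  obtain ⟨V, hV⟩ := exists_unitary_rows_overlap hmn
  have hγ0 : γ = 0 := by
    -- This entry is 0 for the diagonal matrix itself and `γ ∑ₖ |V m k|² |V n k|²` after
    -- conjugation.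
    have h := congrFun (congrFun (hinv V) (m, m)) (n, n)
    rw [Matrix.diagonal_apply_ne _ (by simpa using hmn), conj_apply] at h
    have e : ∀ k' l' : Fin d, (∑ i', ∑ j', V.1 m i' * star (V.1 m j') *
        (Matrix.diagonal (fun a : Fin d × Fin d => if a.1 = a.2 then γ else 0)) (i', j') (k', l'))
        = if k' = l' then γ * (V.1 m k' * star (V.1 m k')) else 0 := by
      intro k' l'
      rw [← Fintype.sum_prod_type' (f := fun i' j' => V.1 m i' * star (V.1 m j') *
        (Matrix.diagonal (fun a : Fin d × Fin d => if a.1 = a.2 then γ else 0)) (i', j') (k', l'))]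
      rw [Finset.sum_eq_single (k', l')]
      · by_cases hkl : k' = l'
        · subst hkl; simp [mul_comm]
        · simp [hkl]
      · intro b _ hb
        rw [Matrix.diagonal_apply_ne _ hb, mul_zero]
      · simp
    simp only [e] at h
    simp only [ite_mul, zero_mul, Finset.sum_ite_eq, Finset.mem_univ, if_true, mul_assoc,
      ← Finset.mul_sum] at h
    simp only [mul_assoc] at hV
    exact (mul_eq_zero.1 h).resolve_right hV
  refine ⟨d * T (m, m) (n, n), T (m, n) (m, n), ?_⟩
  rw [← sub_eq_zero, hdiag, hγ0]
  ext a b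
  simp [Matrix.diagonal]

/-! ### The twirl of a state is isotropic -/

theorem fidelity_mem {d : ℕ} (hd : 2 ≤ d) {σ : Op d} (hσ : IsState σ) :
    (maxEnt d * σ).trace = fidelity σ ∧ 0 ≤ fidelity σ ∧ fidelity σ ≤ 1 := by
  have key : ∀ P : Op d, P.PosSemidef → P * P = P → 0 ≤ (P * σ).trace := fun P hP h2 => by
    have := (hσ.1.conjTranspose_mul_mul_same P).trace_nonneg
    rwa [hP.isHermitian.eq, Matrix.trace_mul_comm, ← mul_assoc, h2] at this
  have h1 := key _ (maxEnt_posSemidef hd) (maxEnt_mul_self hd)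
  have h2 := key _ (one_sub_maxEnt_posSemidef hd)
    (by simp [mul_sub, sub_mul, maxEnt_mul_self hd])
  rw [sub_mul, one_mul, Matrix.trace_sub, hσ.2] at h2
  obtain ⟨h1r, h1i⟩ := Complex.le_def.1 h1
  have h2r := (Complex.le_def.1 h2).1
  simp only [Complex.zero_re, Complex.sub_re, Complex.one_re, Complex.zero_im] at h1r h1i h2r
  exact ⟨Complex.ext (by simp [fidelity]) (by simp [← h1i]), h1r, by unfold fidelity; linarith⟩

theorem twirl_eq_iso {d : ℕ} (hd : 2 ≤ d) {σ : Op d} (hσ : IsState σ) :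
    ∃ q ∈ isoRange d, twirl σ = iso d q ∧ isoTop d q = fidelity σ := by
  have h2 := two_le_cast hd
  have hD : (0 : ℝ) < (d : ℝ) ^ 2 - 1 := by nlinarith
  obtain ⟨hf, hf0, hf1⟩ := fidelity_mem hd hσ
  obtain ⟨α, β, hT⟩ := exists_of_invariant hd (conj_twirl σ)
  have ht := trace_twirl σ
  have hp := trace_maxEnt_mul_twirl σ
  rw [hT, hσ.2] at ht
  rw [hT, hf] at hp
  simp only [Matrix.trace_add, Matrix.trace_smul, trace_maxEnt hd, Matrix.trace_one, mul_add,
    Matrix.mul_smul, maxEnt_mul_self hd, mul_one, smul_eq_mul, Fintype.card_prod,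
    Fintype.card_fin] at ht hp
  push_cast at ht
  -- The solution of `isoTop d q = fidelity σ`; the range `[0, 1]` of the overlap becomes `isoRange
  -- d`.
  set q : ℝ := ((d : ℝ) ^ 2 * fidelity σ - 1) / ((d : ℝ) ^ 2 - 1) with hq
  have hqD : q * ((d : ℝ) ^ 2 - 1) = (d : ℝ) ^ 2 * fidelity σ - 1 := by
    rw [hq]; field_simp
  have hDc : ((d : ℂ) ^ 2 - 1) ≠ 0 := by exact_mod_cast hD.ne'
  have h0 : (d : ℂ) ≠ 0 := by exact_mod_cast (by omega : d ≠ 0)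
  have hqDc : (q : ℂ) * ((d : ℂ) ^ 2 - 1) = (d : ℂ) ^ 2 * fidelity σ - 1 := by exact_mod_cast hqD
  have hα : α = q := by
    apply mul_right_cancel₀ hDc
    rw [hqDc]
    linear_combination (d : ℂ) ^ 2 * hp - ht
  refine ⟨q, ⟨?_, ?_⟩, ?_, ?_⟩
  · rw [hq]
    apply div_le_div_of_nonneg_right _ hD.le
    nlinarith
  · rw [hq, div_le_one hD]
    nlinarith
  · rw [hT, iso, hα]
    congr 2
    rw [hα] at ht
    push_cast
    field_simp
    linear_combination ht
  · rw [isoTop, hqD]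
    field_simp
    ring

/-! ### Reduction to one parameter and the value of the bound -/

theorem B2pair_iso {d : ℕ} (hd : 2 ≤ d) {lam q : ℝ} (hq : q ∈ isoRange d)
    (hs : IsoSupp d lam q) :
    B2pair (iso d lam) (iso d q) =
      ((2 * Real.logb 2 (d : ℝ) - entropy (iso d lam) + isoObjective d lam q : ℝ) : EReal) := by
  rw [B2pair, relEntropy, if_pos (isoSupp_mulVec hd hs), opNorm_partialTranspose_iso hd hq,
    trace_iso_mul_matLog_iso hd lam q, ← EReal.coe_add, ← EReal.coe_add, entropy, isoObjective]
  congr 1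
  ring

theorem B2pair_iso_le {d : ℕ} (hd : 2 ≤ d) {lam q : ℝ} (hlam : lam ∈ isoRange d)
    (hq : q ∈ isoRange d) {σ : Op d} (hσ : IsState σ) (hqσ : isoTop d q = fidelity σ)
    (htop : B2pair (iso d lam) σ ≠ ⊤) :
    IsoSupp d lam q ∧ B2pair (iso d lam) (iso d q) ≤ B2pair (iso d lam) σ := by
  -- If the supports are not nested the relative entropy is `⊤`, and adding real terms keeps it
  -- there.
  have hsupp : ∀ v : Fin d × Fin d → ℂ, σ.mulVec v = 0 → (iso d lam).mulVec v = 0 := by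
    by_contra h
    refine htop ?_
    rw [B2pair, relEntropy, if_neg h, EReal.coe_add_top, EReal.top_add_coe]
  obtain ⟨hs, hle⟩ := iso_trace_matLog_le hd hlam hσ hsupp hqσ
  refine ⟨hs, ?_⟩
  have hN := Real.logb_le_logb_of_le (b := 2) (by norm_num) (isoNorm_pos hd hq)
    (isoNorm_le_opNorm hd hσ.2 hqσ)
  rw [B2pair_iso hd hq hs, B2pair, relEntropy, if_pos hsupp, ← EReal.coe_add, ← EReal.coe_add,
    EReal.coe_le_coe_iff, entropy, isoObjective]
  linarith

theorem B2pair_twirl_le {d : ℕ} (hd : 2 ≤ d) {lam : ℝ} (hlam : lam ∈ isoRange d) {σ : Op d}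
    (hσ : IsState σ) : B2pair (iso d lam) (twirl σ) ≤ B2pair (iso d lam) σ := by
  by_cases htop : B2pair (iso d lam) σ = ⊤
  · rw [htop]; exact le_top
  obtain ⟨q, hq, ht, hqσ⟩ := twirl_eq_iso hd hσ
  rw [ht]
  exact (B2pair_iso_le hd hlam hq hσ hqσ htop).2

/-- A minimizer over the isotropic states is a minimizer over all states. -/
theorem B2_iso_eq {d : ℕ} (hd : 2 ≤ d) {lam p : ℝ} (hlam : lam ∈ isoRange d)
    (hp : p ∈ isoRange d) (hs : IsoSupp d lam p)
    (hmin : ∀ q ∈ isoRange d, IsoSupp d lam q → isoObjective d lam p ≤ isoObjective d lam q) :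
    B2 (iso d lam) =
        ((2 * Real.logb 2 (d : ℝ) - entropy (iso d lam) + isoObjective d lam p : ℝ) : EReal)
      ∧ IsOptimal (iso d lam) (iso d p) := by
  have h : B2 (iso d lam) = B2pair (iso d lam) (iso d p) := by
    refine le_antisymm (iInf_le_of_le ⟨iso d p, isState_iso hd hp⟩ le_rfl) (le_iInf fun σ => ?_)
    by_cases htop : B2pair (iso d lam) σ.1 = ⊤
    · rw [htop]; exact le_top
    obtain ⟨q, hq, -, hqσ⟩ := twirl_eq_iso hd σ.2
    obtain ⟨hsq, hle⟩ := B2pair_iso_le hd hlam hq σ.2 hqσ htop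
    refine le_trans ?_ hle
    rw [B2pair_iso hd hp hs, B2pair_iso hd hq hsq, EReal.coe_le_coe_iff]
    linarith [hmin q hq hsq]
  exact ⟨h.trans (B2pair_iso hd hp hs), isState_iso hd hp, h.symm⟩

theorem B2_iso_of_le {d : ℕ} (hd : 2 ≤ d) {lam : ℝ} (hlam : lam ∈ isoRange d)
    (h : lam ≤ 1 / ((d : ℝ) + 1)) :
    B2 (iso d lam) = ((2 * Real.logb 2 (d : ℝ) - entropy (iso d lam) : ℝ) : EReal)
      ∧ (0 : ℝ) ∈ isoRange d ∧ IsOptimal (iso d lam) (iso d 0) := by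
  have h2 := two_le_cast hd
  have h0 : (0 : ℝ) ∈ isoRange d :=
    ⟨div_nonpos_of_nonpos_of_nonneg (by norm_num) (by nlinarith), zero_le_one⟩
  have hs : IsoSupp d lam 0 := by
    have hd0 : d ≠ 0 := by omega
    constructor <;> intro hz <;> simp [isoTop, isoBot, hd0] at hz
  obtain ⟨h1, h3⟩ := B2_iso_eq hd hlam h0 hs fun q hq hsq => by
    rw [isoObjective_zero]
    exact isoObjective_nonneg hd hlam h hq hsq
  rw [isoObjective_zero, add_zero] at h1
  exact ⟨h1, h0, h3⟩

theorem B2_iso_of_ge {d : ℕ} (hd : 2 ≤ d) {lam : ℝ} (hlam : lam ∈ isoRange d)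
    (h : 1 / ((d : ℝ) + 1) ≤ lam) :
    B2 (iso d lam) = ((2 * Real.logb 2 (d : ℝ) - entropy (iso d lam)
        + isoObjective d lam (pParam d lam) : ℝ) : EReal)
      ∧ IsOptimal (iso d lam) (iso d (pParam d lam)) :=
  B2_iso_eq hd hlam (pParam_mem hd h hlam.2) (isoSupp_pParam hd h hlam.2)
    fun _ hq hs => isoObjective_pParam_le hd hlam h hq hs

end QInfo

theorem mainTheorem6 (d : ℕ) (hd : 2 ≤ d) (lam : ℝ) (hlam : lam ∈ QInfo.isoRange d) :
    -- reduction to isotropic states by twirling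
    (∀ σ : QInfo.Op d, QInfo.IsState σ →
      (∃ q ∈ QInfo.isoRange d, QInfo.twirl σ = QInfo.iso d q) ∧
      QInfo.B2pair (QInfo.iso d lam) (QInfo.twirl σ) ≤ QInfo.B2pair (QInfo.iso d lam) σ) ∧
    -- the minimum over all states is attained, at an isotropic state
    (∃ q ∈ QInfo.isoRange d, QInfo.IsOptimal (QInfo.iso d lam) (QInfo.iso d q)) ∧
    -- the entropy of the isotropic state
    QInfo.entropy (QInfo.iso d lam) =
      -((1 + lam * ((d : ℝ) ^ 2 - 1)) / (d : ℝ) ^ 2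
          * Real.logb 2 ((1 + lam * ((d : ℝ) ^ 2 - 1)) / (d : ℝ) ^ 2))
        - (1 - lam) * ((d : ℝ) ^ 2 - 1) / (d : ℝ) ^ 2
          * Real.logb 2 ((1 - lam) / (d : ℝ) ^ 2) ∧
    -- the value of the bound
    (lam ≤ 1 / ((d : ℝ) + 1) →
      QInfo.B2 (QInfo.iso d lam) =
        ((2 * Real.logb 2 (d : ℝ) - QInfo.entropy (QInfo.iso d lam) : ℝ) : EReal)) ∧
    (1 / ((d : ℝ) + 1) ≤ lam → lam < 1 →
      QInfo.B2 (QInfo.iso d lam) =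
        ((2 * Real.logb 2 (d : ℝ) - QInfo.entropy (QInfo.iso d lam)
          + Real.logb 2 ((1 + QInfo.pParam d lam * ((d : ℝ) - 1)) / (1 - QInfo.pParam d lam))
          + (1 + lam * ((d : ℝ) ^ 2 - 1)) / (d : ℝ) ^ 2
            * Real.logb 2 ((1 - QInfo.pParam d lam)
                / (1 + QInfo.pParam d lam * ((d : ℝ) ^ 2 - 1))) : ℝ) : EReal)) ∧
    (lam = 1 → QInfo.B2 (QInfo.iso d lam) = ((Real.logb 2 (d : ℝ) : ℝ) : EReal))
 := by
  refine ⟨fun σ hσ => ⟨?_, QInfo.B2pair_twirl_le hd hlam hσ⟩, ?_, QInfo.entropy_iso hd lam,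
    fun h => (QInfo.B2_iso_of_le hd hlam h).1, fun h h1 => ?_, fun h1 => ?_⟩
  · obtain ⟨q, hq, ht, -⟩ := QInfo.twirl_eq_iso hd hσ
    exact ⟨q, hq, ht⟩
  · rcases le_total lam (1 / ((d : ℝ) + 1)) with h | h
    · exact ⟨0, (QInfo.B2_iso_of_le hd hlam h).2⟩
    · exact ⟨QInfo.pParam d lam, QInfo.pParam_mem hd h hlam.2, (QInfo.B2_iso_of_ge hd hlam h).2⟩
  · rw [(QInfo.B2_iso_of_ge hd hlam h).1, QInfo.isoObjective_pParam_of_lt_one hd h h1,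
      ← add_assoc]
  · subst h1
    have h2 := QInfo.two_le_cast hd
    have h : 1 / ((d : ℝ) + 1) ≤ 1 := by
      rw [div_le_one (by positivity)]
      linarith
    have h0 : (d : ℝ) ≠ 0 := by positivity
    have hS : QInfo.entropy (QInfo.iso d 1) = 0 := by
      rw [QInfo.entropy_iso hd]
      simp [h0]
    rw [(QInfo.B2_iso_of_ge hd hlam h).1, hS, QInfo.isoObjective_pParam_one hd]
    congr 1
    ring
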